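/- Let $U\subset\mathbb{R}$ be a non-empty open set, let $u:U\to\mathbb{R}$, and let $g:U\to\mathbb{R}^2$, $g(t)=(t,u(t))$. For an open set $X\subset\mathbb{R}^2$ with $g(U)\subset X$, let $C^\omega(X)$ be the set of real-analytic functions $X\to\mathbb{R}$. We say that $g$ is non-trivially annihilated in $C^\omega(X)$ if there is $H\in C^\omega(X)$, not identically zero on $X$, with $H(t,u(t))=0$ for all $t\in U$. 1. Suppose that $U$ is an interval (i.e. connected) and $u\in C^\infty(U)$. Then $g$ is non-trivially annihilated in $C^\omega(U\times\mathbb{R})$ if and only if $u$ is real-analytic on $U$. (For $U=\mathbb{R}$ the class is $C^\omega(\mathbb{R}^2)$.) Moreover, if $F\in C^\omega(U\times\mathbb{R})$ and $w:U\to\mathbb{R}$ satisfy $F(t,u(t))=w(t)$ for all $t\in U$, then $F$ is the only function in $C^\omega(U\times\mathbb{R})$ with this property if and only if $u$ is not real-analytic on $U$. 2. Suppose that $U$ is an interval, that $u$ is merely differentiable on $U$, and that $u$ solves $u_t(t)=F(t,u(t))$ on $U$ for some $F\in C^\omega(U\times\mathbb{R})$. Then $g$ is non-trivially annihilated in $C^\omega(U\times\mathbb{R})$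 if and only if $u$ is real-analytic on $U$, and $F$ is the only function in $C^\omega(U\times\mathbb{R})$ with $u_t(t)=F(t,u(t))$ for all $t\in U$ if and only if $u$ is not real-analytic on $U$. 3. For arbitrary non-empty open $U$: if $u\in C^\infty(U)$ and $g$ is non-trivially annihilated in $C^\omega(\mathbb{R}^2)$, then $u$ is real-analytic on $U$. 4. For arbitrary non-empty open $U$: if $u$ is real-analytic on $U$, then $g$ is non-trivially annihilated in $C^\omega(U\times\mathbb{R})$. -/

import Mathlib

open Set
open scoped ContDiff

/-- The class `C^ω(X)` of real-analytic functions on a set `X` (used for open `X`). A function on `X`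
is represented by a total function, whose values outside `X` are never used. -/
def analyticClass {E : Type*} [NormedAddCommGroup E] [NormedSpace ℝ E] (X : Set E) :
    Set (E → ℝ) :=
  {H | AnalyticOnNhd ℝ H X}

/-- `g : U → X` is non-trivially annihilated in the class `V` of functions `X → ℝ`: some `H ∈ V`,
not the zero function on `X`, satisfies `H ∘ g = 0` on `U`. -/
def NontriviallyAnnihilated {D E : Type*} (U : Set D) (g : D → E) (X : Set E)
    (V : Set (E → ℝ)) : Prop :=
  MapsTo g U X ∧ ∃ H ∈ V, (∃ x ∈ X, H x ≠ 0) ∧ ∀ t ∈ U, H (g t) = 0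

/-- `F` is the unique function `X → ℝ` in the class `V` with `F ∘ g = w` on `U`. -/
def IsUniqueSolvedBy {D E : Type*} (U : Set D) (g : D → E) (X : Set E) (V : Set (E → ℝ))
    (w : D → ℝ) (F : E → ℝ) : Prop :=
  (F ∈ V ∧ ∀ t ∈ U, F (g t) = w t) ∧
    ∀ G ∈ V, (∀ t ∈ U, G (g t) = w t) → EqOn G F X

/-- The map `t ↦ (t, u(t))`. -/
def graphMap (u : ℝ → ℝ) : ℝ → ℝ × ℝ := fun t => (t, u t)

/-! ### Dividing analytic germs by a coordinate. -/

open Filter Topology Asymptotics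

/-! If `u` is analytic, `y - u t` annihilates its graph. The converse is local: on a connected `X`
the identity theorem makes the germ of a non-trivial annihilator `F` non-zero at every point, so it
suffices that a smooth `u` killed by a non-zero analytic germ is analytic.

Move the point to the origin and strip powers of `t`, so that `F (0, y)` is not identically zero.
Not all vertical derivatives of `F` can then be flat (vanish to infinite order) along the graph, so
some vertical derivative `A` is flat there while its own vertical derivative is not
(`exists_flat_and_fderiv_not_flat`). Starting from a Taylor polynomial of `u`, rescaling and the
implicit function theorem yield an analytic `q` with `u - q` flat (`exists_analyticAt_sub_flat`).
Finally `w = u - q` is annihilated by the non-zero germ `F (t, q t + w)`, and a flat `w` with this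
property is zero (`eventually_eq_zero_of_analyticAt_of_flat`).

Uniqueness is the absence of a non-trivial annihilator, since two solutions differ by one. -/

theorem AnalyticAt.integral_comp_continuousLinearMap {E F : Type*} [NormedAddCommGroup E]
    [NormedSpace ℝ E] [NormedAddCommGroup F] [NormedSpace ℝ F] [CompleteSpace F] {f : E → F}
    (hf : AnalyticAt ℝ f 0) {L : ℝ → E →L[ℝ] E} (hL : Continuous L)
    (hL1 : ∀ r ∈ Icc (0 : ℝ) 1, ‖L r‖ ≤ 1) :
    AnalyticAt ℝ (fun x => ∫ r in (0 : ℝ)..1, f (L r x)) 0 := by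
  obtain ⟨q, ρ, hq⟩ := hf
  have hcont : ∀ n, Continuous fun r => (q n).compContinuousLinearMap (fun _ => L r) := by
    intro n
    exact ((ContinuousMultilinearMap.compContinuousLinearMapContinuousMultilinear ℝ
      (fun _ : Fin n => E) (fun _ : Fin n => E) F).cont.comp
        (continuous_pi fun _ => hL)).clm_apply continuous_const
  have hnorm : ∀ n, ∀ r ∈ Icc (0 : ℝ) 1,
      ‖(q n).compContinuousLinearMap (fun _ => L r)‖ ≤ ‖q n‖ := by
    intro n r hr
    refine (ContinuousMultilinearMap.norm_compContinuousLinearMap_le _ _).trans ?_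
    refine mul_le_of_le_one_right (norm_nonneg _) ?_
    exact Finset.prod_le_one (fun _ _ => norm_nonneg _) fun _ _ => hL1 r hr
  -- Averaging the coefficients over `r` does not increase their norms, because `L r` is a
  -- contraction; the radius of convergence survives.
  let b : FormalMultilinearSeries ℝ E F := fun n =>
    ∫ r in (0 : ℝ)..1, (q n).compContinuousLinearMap (fun _ => L r)
  have hb : ∀ n, ‖b n‖ ≤ ‖q n‖ := by
    intro n
    have := intervalIntegral.norm_integral_le_of_norm_le_const (a := (0 : ℝ)) (b := 1)
      (f := fun r => (q n).compContinuousLinearMap (fun _ => L r)) (C := ‖q n‖) ?_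
    · simpa [b] using this
    · intro r hr
      rw [uIoc_of_le zero_le_one] at hr
      exact hnorm n r ⟨hr.1.le, hr.2⟩
  refine ⟨b, ρ, ?_, hq.r_pos, ?_⟩
  · refine hq.r_le.trans ?_
    refine ENNReal.le_of_forall_nnreal_lt fun s hs => ?_
    obtain ⟨C, -, hC⟩ := q.norm_mul_pow_le_of_lt_radius hs
    exact b.le_radius_of_bound C fun n =>
      (mul_le_mul_of_nonneg_right (hb n) (by positivity)).trans (hC n)
  · intro y hy
    have hyr : ENNReal.ofReal ‖y‖ < q.radius := by
      refine lt_of_lt_of_le ?_ hq.r_le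
      simpa [Metric.mem_eball, edist_eq_enorm_sub, ofReal_norm] using hy
    have hsum : Summable fun n => ‖q n‖ * ‖y‖ ^ n := by
      have h := q.summable_norm_mul_pow (r := ⟨‖y‖, norm_nonneg y⟩) (by
        convert hyr using 1
        rw [ENNReal.ofReal, Real.toNNReal_of_nonneg (norm_nonneg y)]
        rfl)
      exact h
    have key := intervalIntegral.hasSum_integral_of_dominated_convergence
      (μ := MeasureTheory.volume) (a := (0 : ℝ)) (b := 1)
      (F := fun n r => q n fun _ => L r y) (f := fun r => f (L r y))
      (fun n _ => ‖q n‖ * ‖y‖ ^ n) ?_ ?_ ?_ ?_ ?_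
    · simp only [zero_add]
      convert key using 2 with n
      have := (ContinuousMultilinearMap.apply ℝ (fun _ : Fin n => E) F
        (fun _ => y)).intervalIntegral_comp_comm ((hcont n).intervalIntegrable (μ := MeasureTheory.volume) 0 1)
      simpa [b] using this.symm
    · intro n
      refine Continuous.aestronglyMeasurable ?_
      exact (q n).cont.comp (continuous_pi fun _ => hL.clm_apply continuous_const)
    · intro n
      refine Eventually.of_forall fun r hr => ?_
      rw [uIoc_of_le zero_le_one] at hr
      refine ((q n).le_opNorm _).trans ?_
      simp only [Finset.prod_const, Finset.card_univ, Fintype.card_fin]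
      have : ‖L r y‖ ≤ ‖y‖ := (L r).le_of_opNorm_le_of_le (hL1 r ⟨hr.1.le, hr.2⟩) le_rfl |>.trans
        (by simp)
      gcongr
    · exact Eventually.of_forall fun _ _ => hsum
    · exact intervalIntegrable_const
    · refine Eventually.of_forall fun r hr => ?_
      rw [uIoc_of_le zero_le_one] at hr
      have hle : ‖L r y‖ ≤ ‖y‖ :=
        (L r).le_of_opNorm_le_of_le (hL1 r ⟨hr.1.le, hr.2⟩) le_rfl |>.trans (by simp)
      have hmem : L r y ∈ Metric.eball (0 : E) ρ := by
        rw [Metric.mem_eball, edist_zero_right] at hy ⊢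
        refine lt_of_le_of_lt ?_ hy
        rwa [enorm_le_iff_norm_le]
      simpa using hq.hasSum hmem

/-- Analytic form of Hadamard's lemma. -/
theorem AnalyticAt.exists_eq_add_fst_mul {E : Type*} [NormedAddCommGroup E] [NormedSpace ℝ E]
    {A : ℝ × E → ℝ} (hA : AnalyticAt ℝ A 0) :
    ∃ B : ℝ × E → ℝ, AnalyticAt ℝ B 0 ∧ ∀ᶠ z in 𝓝 (0 : ℝ × E), A z = A (0, z.2) + z.1 * B z := by
  let g : ℝ × E → ℝ := fun z => fderiv ℝ A z (1, 0)
  have hg : AnalyticAt ℝ g 0 := by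
    exact (ContinuousLinearMap.analyticAt (ContinuousLinearMap.apply ℝ ℝ ((1 : ℝ), (0 : E))) _).comp
      hA.fderiv
  -- `L r` shrinks the first coordinate by `r`; integrating the first partial derivative along this
  -- segment gives the quotient `B`.
  let L : ℝ → (ℝ × E) →L[ℝ] (ℝ × E) := fun r =>
    (r • ContinuousLinearMap.inl ℝ ℝ E).comp (ContinuousLinearMap.fst ℝ ℝ E) +
      (ContinuousLinearMap.inr ℝ ℝ E).comp (ContinuousLinearMap.snd ℝ ℝ E)
  have hLapp : ∀ r z, L r z = (r * z.1, z.2) := by intro r z; simp [L]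
  have hLc : Continuous L := by
    refine Continuous.add ?_ continuous_const
    exact (continuous_id.smul continuous_const).clm_comp continuous_const
  have hLn : ∀ r ∈ Icc (0 : ℝ) 1, ∀ z : ℝ × E, ‖(r * z.1, z.2)‖ ≤ ‖z‖ := by
    intro r hr z
    refine max_le ?_ (norm_snd_le z)
    refine le_trans ?_ (norm_fst_le z)
    rw [norm_mul, Real.norm_of_nonneg hr.1]
    exact mul_le_of_le_one_left (norm_nonneg _) hr.2
  refine ⟨fun z => ∫ r in (0 : ℝ)..1, g (L r z), hg.integral_comp_continuousLinearMap hLc ?_, ?_⟩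
  · intro r hr
    refine ContinuousLinearMap.opNorm_le_bound _ zero_le_one fun z => ?_
    rw [hLapp, one_mul]
    exact hLn r hr z
  · obtain ⟨ε, hε, hball⟩ := Metric.eventually_nhds_iff_ball.1
      (hA.eventually_analyticAt.and hg.eventually_analyticAt)
    filter_upwards [Metric.ball_mem_nhds _ hε] with z hz
    have hmem : ∀ r ∈ Icc (0 : ℝ) 1, (r * z.1, z.2) ∈ Metric.ball (0 : ℝ × E) ε := by
      intro r hr
      rw [mem_ball_zero_iff] at hz ⊢
      exact (hLn r hr z).trans_lt hz
    have hpath : ∀ r : ℝ, HasDerivAt (fun r : ℝ => (r * z.1, z.2)) (z.1, (0 : E)) r := by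
      intro r
      exact (by simpa using (hasDerivAt_id r).mul_const z.1 : HasDerivAt (fun r : ℝ => r * z.1) z.1 r).prodMk
        (hasDerivAt_const r z.2)
    have key := intervalIntegral.integral_eq_sub_of_hasDerivAt (a := (0 : ℝ)) (b := 1)
      (f := fun r => A (r * z.1, z.2)) (f' := fun r => z.1 * g (r * z.1, z.2)) ?_ ?_
    · simp only [hLapp]
      rw [intervalIntegral.integral_const_mul] at key
      rw [key]; simp
    · intro r hr
      rw [uIcc_of_le zero_le_one] at hr
      have := (hball _ (hmem r hr)).1.differentiableAt.hasFDerivAt.comp_hasDerivAt r (hpath r)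
      have hsmul : (z.1, (0 : E)) = z.1 • ((1 : ℝ), (0 : E)) := by simp
      rw [hsmul, map_smul, smul_eq_mul] at this
      exact this
    · refine ContinuousOn.intervalIntegrable ?_
      rw [uIcc_of_le zero_le_one]
      intro r hr
      refine ContinuousAt.continuousWithinAt ?_
      exact continuousAt_const.mul
        (ContinuousAt.comp (f := fun r : ℝ => (r * z.1, z.2)) (g := g)
          (hball _ (hmem r hr)).2.continuousAt (hpath r).continuousAt)

/-- The lowest non-zero homogeneous term of the power series would dominate near the origin, against
the bound of one order more. -/
theorem AnalyticAt.eventually_eq_zero_of_isBigO {E : Type*} [NormedAddCommGroup E]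
    [NormedSpace ℝ E] {f : E → ℝ} (hf : AnalyticAt ℝ f 0)
    (h : ∀ n : ℕ, f =O[𝓝 0] fun z => ‖z‖ ^ n) : ∀ᶠ z in 𝓝 0, f z = 0 := by
  obtain ⟨p, hp⟩ := hf
  have hzero : ∀ n, ∀ y : E, (p n fun _ => y) = 0 := by
    intro n
    refine Nat.strong_induction_on n fun k hk => ?_
    have psum_eq : p.partialSum (k + 1) = fun y => p k fun _ => y := by
      funext z
      refine Finset.sum_eq_single _ (fun b hb hnb => ?_) fun hn => ?_
      · have := Finset.mem_range_succ_iff.mp hb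
        simp only [hk b (this.lt_of_ne hnb)]
      · exact False.elim (hn (Finset.mem_range.mpr (lt_add_one k)))
    have h1 := hp.isBigO_sub_partialSum_pow k.succ
    simp only [psum_eq, zero_add] at h1
    have h2 := (h k.succ).sub h1
    simp only [sub_sub_cancel] at h2
    exact h2.continuousMultilinearMap_apply_eq_zero
  obtain ⟨r, hr⟩ := hp
  filter_upwards [Metric.eball_mem_nhds (0 : E) hr.r_pos] with z hz
  have := hr.hasSum hz
  simp only [hzero, zero_add] at this
  exact this.unique hasSum_zero

/-- A non-zero germ is a power of the first coordinate times a germ that does not vanish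
identically on the hyperplane where that coordinate is zero. -/
theorem AnalyticAt.exists_eq_fst_pow_mul {E : Type*} [NormedAddCommGroup E] [NormedSpace ℝ E]
    {A : ℝ × E → ℝ} (hA : AnalyticAt ℝ A 0) (hne : ¬ ∀ᶠ z in 𝓝 0, A z = 0) :
    ∃ (k : ℕ) (B : ℝ × E → ℝ), AnalyticAt ℝ B 0 ∧ (∀ᶠ z in 𝓝 0, A z = z.1 ^ k * B z) ∧
      ¬ ∀ᶠ y in 𝓝 (0 : E), B (0, y) = 0 := by
  by_contra! hcon
  -- If every quotient vanishes on the hyperplane, Hadamard's lemma always extracts one more factor,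
  -- so `A` vanishes to every order.
  have hall : ∀ k : ℕ, ∃ B : ℝ × E → ℝ, AnalyticAt ℝ B 0 ∧
      ∀ᶠ z in 𝓝 0, A z = z.1 ^ k * B z := by
    intro k
    induction k with
    | zero => exact ⟨A, hA, by simp⟩
    | succ k ih =>
      obtain ⟨B, hB, hAB⟩ := ih
      have hB0 := hcon k B hB hAB
      obtain ⟨C, hC, hBC⟩ := hB.exists_eq_add_fst_mul
      refine ⟨C, hC, ?_⟩
      have hB0' : ∀ᶠ z in 𝓝 (0 : ℝ × E), B (0, z.2) = 0 :=
        (continuous_snd.tendsto (0 : ℝ × E)).eventually hB0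
      filter_upwards [hAB, hBC, hB0'] with z h1 h2 h3
      rw [h1, h2, h3]; ring
  refine hne (hA.eventually_eq_zero_of_isBigO fun n => ?_)
  obtain ⟨B, hB, hAB⟩ := hall n
  have h1 : (fun z : ℝ × E => z.1 ^ n * B z) =O[𝓝 0] fun z => ‖z‖ ^ n * 1 := by
    refine IsBigO.mul ?_ (hB.continuousAt.isBigO_one ℝ)
    exact IsBigO.pow (IsBigO.of_bound 1 (Eventually.of_forall fun z => by
      simpa using norm_fst_le z)) n
  exact (h1.congr' (hAB.mono fun _ h => h.symm) (by simp))

/-! ### Orders of vanishing in one variable. -/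

/-- Cancelling `t ^ m` gives nothing at `t = 0` when `m ≠ 0`; hence the assumption on `f 0`. -/
theorem isBigO_pow_of_isBigO_pow_mul {f : ℝ → ℝ} {m n : ℕ} (h0 : f 0 = 0)
    (h : (fun t => t ^ m * f t) =O[𝓝 0] fun t : ℝ => t ^ (m + n)) :
    f =O[𝓝 0] fun t : ℝ => t ^ n := by
  obtain ⟨C, hC⟩ := h.bound
  refine IsBigO.of_bound |C| ?_
  filter_upwards [hC] with t ht
  rcases eq_or_ne t 0 with rfl | htz
  · rw [h0, norm_zero]; positivity
  · rw [norm_mul, pow_add, norm_mul] at ht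
    have hpos : 0 < ‖t ^ m‖ := norm_pos_iff.2 (pow_ne_zero _ htz)
    have h1 : ‖f t‖ ≤ C * ‖t ^ n‖ := by
      refine le_of_mul_le_mul_left ?_ hpos
      linarith
    exact h1.trans (by gcongr; exact le_abs_self C)

theorem eq_zero_of_isBigO_pow {f : ℝ → ℝ} {n : ℕ} (hn : n ≠ 0)
    (h : f =O[𝓝 0] fun t : ℝ => t ^ n) : f 0 = 0 := by
  obtain ⟨C, hC⟩ := h.bound
  simpa [hn] using hC.self_of_nhds

theorem isBigO_pow_pow_of_le {m n : ℕ} (h : m ≤ n) :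
    (fun t : ℝ => t ^ n) =O[𝓝 0] fun t : ℝ => t ^ m := by
  obtain ⟨k, rfl⟩ := Nat.exists_eq_add_of_le h
  have : (fun t : ℝ => t ^ k) =O[𝓝 0] fun _ : ℝ => (1 : ℝ) :=
    (continuous_pow k).continuousAt.isBigO_one ℝ
  simpa [pow_add] using (isBigO_refl (fun t : ℝ => t ^ m) (𝓝 0)).mul this

theorem AnalyticAt.exists_eq_pow_mul_ne_zero {f : ℝ → ℝ} (hf : AnalyticAt ℝ f 0)
    (hne : ¬ ∀ᶠ t in 𝓝 0, f t = 0) :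
    ∃ (d : ℕ) (b : ℝ → ℝ), AnalyticAt ℝ b 0 ∧ b 0 ≠ 0 ∧ ∀ᶠ t in 𝓝 0, f t = t ^ d * b t := by
  obtain ⟨d, b, hb, hb0, hfb⟩ := hf.exists_eventuallyEq_pow_smul_nonzero_iff.2 hne
  exact ⟨d, b, hb, hb0, by simpa using hfb⟩

theorem AnalyticAt.exists_eq_pow_mul_of_isBigO {f : ℝ → ℝ} (hf : AnalyticAt ℝ f 0) {m : ℕ}
    (h : f =O[𝓝 0] fun t : ℝ => t ^ m) :
    ∃ a : ℝ → ℝ, AnalyticAt ℝ a 0 ∧ ∀ᶠ t in 𝓝 0, f t = t ^ m * a t := by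
  by_cases hz : ∀ᶠ t in 𝓝 0, f t = 0
  · exact ⟨fun _ => 0, analyticAt_const, by simpa using hz⟩
  obtain ⟨d, b, hb, hb0, hfb⟩ := hf.exists_eq_pow_mul_ne_zero hz
  rcases le_or_gt m d with hmd | hmd
  · obtain ⟨k, rfl⟩ := Nat.exists_eq_add_of_le hmd
    refine ⟨fun t => t ^ k * b t, by fun_prop, ?_⟩
    filter_upwards [hfb] with t ht
    rw [ht, pow_add, mul_assoc]
  · obtain ⟨k, rfl⟩ := Nat.exists_eq_add_of_lt hmd
    exfalso
    have h1 : (fun t => t ^ d * b t) =O[𝓝 0] fun t : ℝ => t ^ (d + (k + 1)) :=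
      h.congr' hfb (EventuallyEq.of_eq (by simp only [add_assoc]))
    obtain ⟨C, hC⟩ := h1.bound
    have h2 : ∀ᶠ t in 𝓝[≠] (0 : ℝ), ‖b t‖ ≤ C * ‖t ^ (k + 1)‖ := by
      filter_upwards [hC.filter_mono nhdsWithin_le_nhds, self_mem_nhdsWithin] with t ht htz
      rw [norm_mul, pow_add, norm_mul] at ht
      refine le_of_mul_le_mul_left ?_ (norm_pos_iff.2 (pow_ne_zero d htz))
      linarith
    have h3 : Tendsto (fun t => ‖b t‖) (𝓝[≠] 0) (𝓝 ‖b 0‖) :=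
      hb.continuousAt.norm.tendsto.mono_left nhdsWithin_le_nhds
    have h4 : Tendsto (fun t : ℝ => C * ‖t ^ (k + 1)‖) (𝓝[≠] 0) (𝓝 0) := by
      have : Continuous fun t : ℝ => C * ‖t ^ (k + 1)‖ := by fun_prop
      simpa using (this.tendsto 0).mono_left nhdsWithin_le_nhds
    exact hb0 (norm_le_zero_iff.1 (le_of_tendsto_of_tendsto h3 h4 h2))

/-! ### Flatness along a curve of zeros. -/

/-- A function that vanishes to infinite order and annihilates a non-zero analytic germ is zero. -/
theorem eventually_eq_zero_of_analyticAt_of_flat {Φ : ℝ × ℝ → ℝ} (hΦ : AnalyticAt ℝ Φ 0)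
    (hne : ¬ ∀ᶠ z in 𝓝 0, Φ z = 0) {w : ℝ → ℝ} (hw : ∀ n : ℕ, w =O[𝓝 0] fun t : ℝ => t ^ n)
    (h : ∀ᶠ t in 𝓝 0, Φ (w t, t) = 0) : ∀ᶠ t in 𝓝 0, w t = 0 := by
  obtain ⟨k, B, hB, hΦB, hBne⟩ := hΦ.exists_eq_fst_pow_mul hne
  have hB0 : AnalyticAt ℝ (fun t : ℝ => B (0, t)) 0 :=
    AnalyticAt.comp (g := B) (f := fun t : ℝ => ((0 : ℝ), t)) hB
      (analyticAt_const.prod analyticAt_id)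
  obtain ⟨d, b, hb, hb0, hBb⟩ := hB0.exists_eq_pow_mul_ne_zero hBne
  have hw0 : w 0 = 0 := eq_zero_of_isBigO_pow one_ne_zero (hw 1)
  have hwc : Tendsto w (𝓝 0) (𝓝 0) := by
    refine (hw 1).trans_tendsto ?_
    simpa using (continuous_pow 1).tendsto (0 : ℝ)
  have hwt : Tendsto (fun t => (w t, t)) (𝓝 0) (𝓝 (0 : ℝ × ℝ)) := hwc.prodMk_nhds tendsto_id
  have h0t : Tendsto (fun t : ℝ => ((0 : ℝ), t)) (𝓝 0) (𝓝 (0 : ℝ × ℝ)) :=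
    tendsto_const_nhds.prodMk_nhds tendsto_id
  have hdiff : (fun t => B (w t, t) - B (0, t)) =O[𝓝 0] w := by
    have h1 := hB.hasStrictFDerivAt.isBigO_sub.comp_tendsto (hwt.prodMk_nhds h0t)
    refine h1.trans (IsBigO.of_bound 1 (Eventually.of_forall fun t => ?_))
    simp [Prod.norm_def]
  -- Where `w t ≠ 0`, `B (w t, t) = 0`, so `B (0, t)`, of exact order `d`, would be bounded by `C *
  -- |t| ^ (d + 1)`.
  obtain ⟨C, hC⟩ := (hdiff.trans (hw (d + 1))).bound
  have hsmall : ∀ᶠ t in 𝓝 (0 : ℝ), C * ‖t‖ < ‖b t‖ := by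
    have h1 : Tendsto (fun t : ℝ => C * ‖t‖) (𝓝 0) (𝓝 0) := by
      have : Continuous fun t : ℝ => C * ‖t‖ := by fun_prop
      simpa using this.tendsto 0
    exact h1.eventually_lt hb.continuousAt.norm.tendsto (norm_pos_iff.2 hb0)
  filter_upwards [h, hwt.eventually hΦB, hBb, hC, hsmall] with t h1 h2 h3 h4 h5
  by_contra hwne
  have htz : t ≠ 0 := by rintro rfl; exact hwne hw0
  rw [h1] at h2
  have hBz : B (w t, t) = 0 := by
    rcases mul_eq_zero.1 h2.symm with h | h
    · exact absurd h (pow_ne_zero _ hwne)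
    · exact h
  rw [hBz, zero_sub, norm_neg, h3, norm_mul, pow_succ, norm_mul] at h4
  have : ‖b t‖ ≤ C * ‖t‖ := by
    refine le_of_mul_le_mul_left ?_ (norm_pos_iff.2 (pow_ne_zero d htz))
    linarith
  linarith

/-- Along a curve of zeros, a suitable iterated vertical derivative is flat while its vertical
derivative is not. -/
theorem exists_flat_and_fderiv_not_flat {F : ℝ × ℝ → ℝ} (hF : AnalyticAt ℝ F 0)
    (hne : ¬ ∀ᶠ y in 𝓝 (0 : ℝ), F (0, y) = 0) {u : ℝ → ℝ} (hu0 : u 0 = 0)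
    (h : ∀ᶠ t in 𝓝 0, F (t, u t) = 0) :
    ∃ A : ℝ × ℝ → ℝ, AnalyticAt ℝ A 0 ∧
      (∀ n : ℕ, (fun t => A (t, u t)) =O[𝓝 0] fun t : ℝ => t ^ n) ∧
      ∃ n : ℕ, ¬ (fun t => fderiv ℝ A (t, u t) (0, 1)) =O[𝓝 0] fun t : ℝ => t ^ n := by
  by_contra! hcon
  have hslice : ∀ A : ℝ × ℝ → ℝ, AnalyticAt ℝ A 0 → AnalyticAt ℝ (fun y : ℝ => A (0, y)) 0 :=
    fun A hA => AnalyticAt.comp (g := A) (f := fun y : ℝ => ((0 : ℝ), y)) hA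
      (analyticAt_const.prod analyticAt_id)
  -- The induction runs over all `A` at once: by `hcon` the vertical derivative of a flat `A` is
  -- again flat.
  have key : ∀ n : ℕ, ∀ A : ℝ × ℝ → ℝ, AnalyticAt ℝ A 0 →
      (∀ n : ℕ, (fun t => A (t, u t)) =O[𝓝 0] fun t : ℝ => t ^ n) →
      iteratedDeriv n (fun y : ℝ => A (0, y)) 0 = 0 := by
    intro n
    induction n with
    | zero =>
      intro A hA hflat
      have := eq_zero_of_isBigO_pow one_ne_zero (hflat 1)
      simpa [hu0] using this
    | succ n ih =>
      intro A hA hflat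
      rw [iteratedDeriv_succ']
      have hD : AnalyticAt ℝ (fun z => fderiv ℝ A z (0, 1)) 0 :=
        (ContinuousLinearMap.analyticAt (ContinuousLinearMap.apply ℝ ℝ ((0 : ℝ), (1 : ℝ))) _).comp
          hA.fderiv
      have heq : deriv (fun y : ℝ => A (0, y)) =ᶠ[𝓝 0] fun y => fderiv ℝ A (0, y) (0, 1) := by
        have h0t : Tendsto (fun t : ℝ => ((0 : ℝ), t)) (𝓝 0) (𝓝 (0 : ℝ × ℝ)) :=
          tendsto_const_nhds.prodMk_nhds tendsto_id
        filter_upwards [h0t.eventually hA.eventually_analyticAt] with y hy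
        have hpath : HasDerivAt (fun y : ℝ => ((0 : ℝ), y)) (0, 1) y :=
          (hasDerivAt_const y (0 : ℝ)).prodMk (hasDerivAt_id y)
        exact (hy.differentiableAt.hasFDerivAt.comp_hasDerivAt y hpath).deriv
      rw [heq.iteratedDeriv_eq]
      exact ih _ hD (hcon A hA hflat)
  refine hne ?_
  rw [← analyticOrderAt_eq_top, ENat.eq_top_iff_forall_ge]
  intro m
  rw [natCast_le_analyticOrderAt_iff_iteratedDeriv_eq_zero (hslice F hF)]
  intro i _
  refine key i F hF fun n => ?_
  exact (isBigO_zero (fun t : ℝ => t ^ n) (𝓝 0)).congr' (h.mono fun _ h => h.symm)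
    EventuallyEq.rfl

/-! ### Analytic approximation up to a flat error. -/

/-- Analytic implicit function theorem in the plane at the origin. -/
theorem AnalyticAt.exists_implicit {G : ℝ × ℝ → ℝ} (hG : AnalyticAt ℝ G 0) (h0 : G 0 = 0)
    (hne : fderiv ℝ G 0 (0, 1) ≠ 0) :
    ∃ y : ℝ → ℝ, AnalyticAt ℝ y 0 ∧ y 0 = 0 ∧ ∀ᶠ t in 𝓝 0, G (t, y t) = 0 := by
  have cdf : ContDiffAt ℝ ω G 0 := hG.contDiffAt
  have hinv : (fderiv ℝ G 0 ∘L ContinuousLinearMap.inr ℝ ℝ ℝ).IsInvertible := by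
    refine ⟨ContinuousLinearEquiv.unitsEquivAut ℝ (Units.mk0 _ hne), ?_⟩
    ext
    simp
  refine ⟨cdf.implicitFunction (by simp) hinv, ?_, ?_, ?_⟩
  · exact (cdf.contDiffAt_implicitFunction (by simp) hinv).analyticAt
  · exact cdf.implicitFunction_apply_self (by simp) hinv
  · simpa [h0] using cdf.eventually_apply_implicitFunction (by simp) hinv

/-- Strict differentiability makes the vertical increments of `G` comparable to those of its linear
part, uniformly near the origin. -/
theorem HasStrictFDerivAt.isBigO_vertical {G : ℝ × ℝ → ℝ} {G' : ℝ × ℝ →L[ℝ] ℝ}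
    (hG : HasStrictFDerivAt G G' 0) (hne : G' (0, 1) ≠ 0) {v y : ℝ → ℝ}
    (hv : Tendsto v (𝓝 0) (𝓝 0)) (hy : Tendsto y (𝓝 0) (𝓝 0)) :
    (fun t => v t - y t) =O[𝓝 0] fun t => G (t, v t) - G (t, y t) := by
  have hvt : Tendsto (fun t => (t, v t)) (𝓝 0) (𝓝 (0 : ℝ × ℝ)) := tendsto_id.prodMk_nhds hv
  have hyt : Tendsto (fun t => (t, y t)) (𝓝 0) (𝓝 (0 : ℝ × ℝ)) := tendsto_id.prodMk_nhds hy
  have h1 := hG.isLittleO.comp_tendsto (hvt.prodMk_nhds hyt)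
  have hlin : ∀ t, G' ((t, v t) - (t, y t)) = G' (0, 1) * (v t - y t) := by
    intro t
    have : (t, v t) - (t, y t) = (v t - y t) • ((0 : ℝ), (1 : ℝ)) := by simp
    rw [this, map_smul, smul_eq_mul, mul_comm]
  have h2 : (fun t => G (t, v t) - G (t, y t) - G' (0, 1) * (v t - y t)) =o[𝓝 0]
      fun t => G' (0, 1) * (v t - y t) := by
    refine IsLittleO.trans_isBigO (g := fun t => (t, v t) - (t, y t)) ?_ ?_
    · refine h1.congr_left fun t => ?_
      simp only [Function.comp_apply, hlin]
    · refine IsBigO.trans ?_ (isBigO_self_const_mul hne _ _)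
      refine IsBigO.of_bound 1 (Eventually.of_forall fun t => ?_)
      simp [Prod.norm_def]
  have h3 := h2.right_isBigO_add
  simp only [sub_add_cancel] at h3
  exact (isBigO_self_const_mul hne (fun t => v t - y t) _).trans h3

/-- Second-order Taylor expansion in the vertical direction along an analytic curve. -/
theorem AnalyticAt.exists_vertical_expansion {A : ℝ × ℝ → ℝ} (hA : AnalyticAt ℝ A 0) {p : ℝ → ℝ}
    (hp : AnalyticAt ℝ p 0) (hp0 : p 0 = 0) :
    ∃ R : ℝ × ℝ → ℝ, AnalyticAt ℝ R 0 ∧ ∀ᶠ z : ℝ × ℝ in 𝓝 0,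
      A (z.2, p z.2 + z.1) =
        A (z.2, p z.2) + z.1 * (fderiv ℝ A (z.2, p z.2) (0, 1) + z.1 * R z) := by
  have hp2 : AnalyticAt ℝ (fun z : ℝ × ℝ => p z.2) 0 :=
    AnalyticAt.comp (g := p) (f := fun z : ℝ × ℝ => z.2) hp analyticAt_snd
  have hcurve : AnalyticAt ℝ (fun z : ℝ × ℝ => (z.2, p z.2 + z.1)) 0 :=
    analyticAt_snd.prod (hp2.add analyticAt_fst)
  have hcomp : AnalyticAt ℝ (fun z : ℝ × ℝ => A (z.2, p z.2 + z.1)) 0 :=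
    AnalyticAt.comp_of_eq hA hcurve (by simp [hp0])
  obtain ⟨B, hB, hAB⟩ := hcomp.exists_eq_add_fst_mul
  obtain ⟨R, hR, hBR⟩ := hB.exists_eq_add_fst_mul
  have hcurve0 : Tendsto (fun t : ℝ => (t, p t)) (𝓝 0) (𝓝 (0 : ℝ × ℝ)) := by
    have h1 : Tendsto p (𝓝 0) (𝓝 0) := by simpa [hp0] using hp.continuousAt.tendsto
    exact tendsto_id.prodMk_nhds h1
  have h0t : Tendsto (fun t : ℝ => ((0 : ℝ), t)) (𝓝 0) (𝓝 (0 : ℝ × ℝ)) :=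
    tendsto_const_nhds.prodMk_nhds tendsto_id
  have hD : ∀ᶠ t in 𝓝 (0 : ℝ), B (0, t) = fderiv ℝ A (t, p t) (0, 1) := by
    filter_upwards [hcurve0.eventually hA.eventually_analyticAt,
      h0t.eventually hB.eventually_analyticAt, h0t.eventually hAB.eventually_nhds] with t h1 h2 h3
    have hpath : HasDerivAt (fun h : ℝ => (t, p t + h)) (0, 1) 0 :=
      (hasDerivAt_const (0 : ℝ) t).prodMk (by simpa using (hasDerivAt_id (0 : ℝ)).const_add (p t))
    have hd1 : HasDerivAt (fun h : ℝ => A (t, p t + h)) (fderiv ℝ A (t, p t) (0, 1)) 0 := by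
      have h1' : HasFDerivAt A (fderiv ℝ A (t, p t)) (t, p t + 0) := by
        simpa using h1.differentiableAt.hasFDerivAt
      exact h1'.comp_hasDerivAt (0 : ℝ) hpath
    have hpath2 : Tendsto (fun h : ℝ => (h, t)) (𝓝 0) (𝓝 (0, t)) :=
      tendsto_id.prodMk_nhds tendsto_const_nhds
    have hBd : DifferentiableAt ℝ (fun h : ℝ => B (h, t)) 0 :=
      DifferentiableAt.comp (g := B) (f := fun h : ℝ => (h, t)) 0 h2.differentiableAt
        (differentiableAt_id.prodMk (differentiableAt_const t))
    have hd2 : HasDerivAt (fun h : ℝ => A (t, p t + 0) + h * B (h, t)) (B (0, t)) 0 := by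
      simpa using ((hasDerivAt_id (0 : ℝ)).mul hBd.hasDerivAt).const_add (A (t, p t + 0))
    exact (hd2.congr_of_eventuallyEq (hpath2.eventually h3)).unique hd1
  refine ⟨R, hR, ?_⟩
  filter_upwards [hAB, hBR, (continuous_snd.tendsto (0 : ℝ × ℝ)).eventually hD] with z h1 h2 h3
  rw [h1, h2, h3, add_zero]

/-- A function with analytic approximations of every order which makes `A` flat, but not the
vertical derivative of `A`, has a convergent Taylor series. -/
theorem exists_analyticAt_sub_flat {A : ℝ × ℝ → ℝ} (hA : AnalyticAt ℝ A 0) {u : ℝ → ℝ}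
    (hu0 : u 0 = 0)
    (hu : ∀ n : ℕ, ∃ p : ℝ → ℝ, AnalyticAt ℝ p 0 ∧ (fun t => u t - p t) =O[𝓝 0] fun t : ℝ => t ^ n)
    (hflat : ∀ n : ℕ, (fun t => A (t, u t)) =O[𝓝 0] fun t : ℝ => t ^ n) {N : ℕ}
    (hN : ¬ (fun t => fderiv ℝ A (t, u t) (0, 1)) =O[𝓝 0] fun t : ℝ => t ^ N) :
    ∃ q : ℝ → ℝ, AnalyticAt ℝ q 0 ∧ q 0 = 0 ∧
      ∀ n : ℕ, (fun t => u t - q t) =O[𝓝 0] fun t : ℝ => t ^ n := by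
  -- Order `N` suffices to carry non-flatness of the vertical derivative from `u` to `p`; the extra
  -- order makes `(u - p) / t ^ N` tend to zero.
  obtain ⟨p, hp, hup⟩ := hu (N + 1)
  have hp0 : p 0 = 0 := by
    have := eq_zero_of_isBigO_pow (Nat.succ_ne_zero N) hup
    rw [hu0] at this; linarith
  have hpt : Tendsto p (𝓝 0) (𝓝 0) := by simpa [hp0] using hp.continuousAt.tendsto
  have hupt : Tendsto (fun t => u t - p t) (𝓝 0) (𝓝 0) := by
    refine hup.trans_tendsto ?_
    simpa using (continuous_pow (N + 1)).tendsto (0 : ℝ)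
  have hut : Tendsto u (𝓝 0) (𝓝 0) := by simpa using hupt.add hpt
  have hgu : Tendsto (fun t => (t, u t)) (𝓝 0) (𝓝 (0 : ℝ × ℝ)) := tendsto_id.prodMk_nhds hut
  have hgp : Tendsto (fun t => (t, p t)) (𝓝 0) (𝓝 (0 : ℝ × ℝ)) := tendsto_id.prodMk_nhds hpt
  have hDA : AnalyticAt ℝ (fun z => fderiv ℝ A z (0, 1)) 0 :=
    (ContinuousLinearMap.analyticAt (ContinuousLinearMap.apply ℝ ℝ ((0 : ℝ), (1 : ℝ))) _).comp
      hA.fderiv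
  have hcurve : AnalyticAt ℝ (fun t => (t, p t)) 0 := analyticAt_id.prod hp
  have hD : AnalyticAt ℝ (fun t => fderiv ℝ A (t, p t) (0, 1)) 0 :=
    AnalyticAt.comp_of_eq hDA hcurve (by simp [hp0])
  have hDN : ¬ (fun t => fderiv ℝ A (t, p t) (0, 1)) =O[𝓝 0] fun t : ℝ => t ^ N := by
    intro hcon
    refine hN ?_
    have h1 := hDA.hasStrictFDerivAt.isBigO_sub.comp_tendsto (hgu.prodMk_nhds hgp)
    have h2 : (fun t => fderiv ℝ A (t, u t) (0, 1) - fderiv ℝ A (t, p t) (0, 1)) =O[𝓝 0]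
        fun t => u t - p t :=
      h1.trans (IsBigO.of_bound 1 (Eventually.of_forall fun t => by simp [Prod.norm_def]))
    have h3 := (h2.trans (hup.trans (isBigO_pow_pow_of_le (Nat.le_succ N)))).add hcon
    simpa using h3
  have hDne : ¬ ∀ᶠ t in 𝓝 0, fderiv ℝ A (t, p t) (0, 1) = 0 := fun hz =>
    hDN ((isBigO_zero (fun t : ℝ => t ^ N) (𝓝 0)).congr' (hz.mono fun _ h => h.symm)
      EventuallyEq.rfl)
  obtain ⟨d, b, hb, hb0, hDb⟩ := hD.exists_eq_pow_mul_ne_zero hDne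
  have hDO : (fun t => fderiv ℝ A (t, p t) (0, 1)) =O[𝓝 0] fun t : ℝ => t ^ d := by
    have := (isBigO_refl (fun t : ℝ => t ^ d) (𝓝 0)).mul (hb.continuousAt.isBigO_one ℝ)
    exact this.congr' (hDb.mono fun _ h => h.symm) (by simp)
  have hdN : d < N := by
    by_contra! hle
    exact hDN (hDO.trans (isBigO_pow_pow_of_le hle))
  obtain ⟨e, rfl⟩ := Nat.exists_eq_add_of_lt hdN
  obtain ⟨R, hR, hAR⟩ := hA.exists_vertical_expansion hp hp0
  have hAp : AnalyticAt ℝ (fun t => A (t, p t)) 0 :=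
    AnalyticAt.comp_of_eq hA hcurve (by simp [hp0])
  have hupR : Tendsto (fun t => (u t - p t, t)) (𝓝 0) (𝓝 (0 : ℝ × ℝ)) :=
    hupt.prodMk_nhds tendsto_id
  -- Here `N = d + e + 1`. Expanding the flat `A (t, u t)` about `p`, the linear term has order `N +
  -- 1 + d` and the quadratic one at least that.
  have hApO : (fun t => A (t, p t)) =O[𝓝 0] fun t : ℝ => t ^ (d + (d + e + 1) + 1) := by
    have hRO : (fun t => R (u t - p t, t)) =O[𝓝 0] fun _ : ℝ => (1 : ℝ) :=
      (hR.continuousAt.tendsto.comp hupR).isBigO_one ℝ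
    have h1 : (fun t => (u t - p t) * R (u t - p t, t)) =O[𝓝 0] fun t : ℝ => t ^ d := by
      have := hup.mul hRO
      simp only [mul_one] at this
      exact this.trans (isBigO_pow_pow_of_le (by omega))
    have h2 := (hflat (d + (d + e + 1) + 1)).sub
      ((hup.mul (hDO.add h1)).congr_right (g₂ := fun t : ℝ => t ^ (d + (d + e + 1) + 1))
        fun t => by ring)
    refine h2.congr' ?_ EventuallyEq.rfl
    filter_upwards [hupR.eventually hAR] with t ht
    simp only [add_sub_cancel] at ht
    rw [ht]; ring
  obtain ⟨a, ha, hAa⟩ := hAp.exists_eq_pow_mul_of_isBigO hApO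
  -- Result of substituting `p t + t ^ N * y` in `A` and dividing by `t ^ (d + N)`. The quadratic
  -- term keeps `t ^ (N - d) = t * t ^ e`, so the vertical derivative at the origin is `b 0 ≠ 0`.
  let G : ℝ × ℝ → ℝ := fun z =>
    z.1 * a z.1 + b z.1 * z.2 + z.1 * z.1 ^ e * z.2 ^ 2 * R (z.1 ^ (d + e + 1) * z.2, z.1)
  have ha1 : AnalyticAt ℝ (fun z : ℝ × ℝ => a z.1) 0 :=
    AnalyticAt.comp (g := a) (f := fun z : ℝ × ℝ => z.1) ha analyticAt_fst
  have hb1 : AnalyticAt ℝ (fun z : ℝ × ℝ => b z.1) 0 :=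
    AnalyticAt.comp (g := b) (f := fun z : ℝ × ℝ => z.1) hb analyticAt_fst
  have hscale : AnalyticAt ℝ (fun z : ℝ × ℝ => (z.1 ^ (d + e + 1) * z.2, z.1)) 0 :=
    ((analyticAt_fst.pow _).mul analyticAt_snd).prod analyticAt_fst
  have hR1 : AnalyticAt ℝ (fun z : ℝ × ℝ => R (z.1 ^ (d + e + 1) * z.2, z.1)) 0 :=
    AnalyticAt.comp_of_eq hR hscale (by simp)
  have hG : AnalyticAt ℝ G 0 :=
    ((analyticAt_fst.mul ha1).add (hb1.mul analyticAt_snd)).add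
      (((analyticAt_fst.mul (analyticAt_fst.pow e)).mul (analyticAt_snd.pow 2)).mul hR1)
  have hG0 : G 0 = 0 := by simp [G]
  have hG' : fderiv ℝ G 0 (0, 1) = b 0 := by
    have hpath : HasDerivAt (fun y : ℝ => ((0 : ℝ), y)) (0, 1) 0 :=
      (hasDerivAt_const (0 : ℝ) (0 : ℝ)).prodMk (hasDerivAt_id 0)
    have h1 : HasDerivAt (fun y : ℝ => G (0, y)) (fderiv ℝ G 0 (0, 1)) 0 :=
      HasFDerivAt.comp_hasDerivAt (l := G) (f := fun y : ℝ => ((0 : ℝ), y)) (0 : ℝ)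
        hG.differentiableAt.hasFDerivAt hpath
    have h2 : HasDerivAt (fun y : ℝ => G (0, y)) (b 0) 0 := by
      simpa [G] using (hasDerivAt_id (0 : ℝ)).const_mul (b 0)
    exact h1.unique h2
  have hAG : ∀ y : ℝ → ℝ, Tendsto y (𝓝 0) (𝓝 0) → ∀ᶠ t in 𝓝 0,
      A (t, p t + t ^ (d + e + 1) * y t) = t ^ (d + (d + e + 1)) * G (t, y t) := by
    intro y hy
    have h1 : Tendsto (fun t => (t ^ (d + e + 1) * y t, t)) (𝓝 0) (𝓝 (0 : ℝ × ℝ)) := by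
      refine Tendsto.prodMk_nhds ?_ tendsto_id
      simpa using ((continuous_pow (d + e + 1)).tendsto (0 : ℝ)).mul hy
    filter_upwards [h1.eventually hAR, hAa, hDb] with t h2 h3 h4
    rw [h2, h3, h4]
    simp only [G]
    ring
  obtain ⟨y, hy, hy0, hGy⟩ := hG.exists_implicit hG0 (by rwa [hG'])
  have hyt : Tendsto y (𝓝 0) (𝓝 0) := by simpa [hy0] using hy.continuousAt.tendsto
  -- Division by zero gives `v 0 = 0`, which is also its limit.
  let v : ℝ → ℝ := fun t => (u t - p t) / t ^ (d + e + 1)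
  have huv : ∀ t, u t - p t = t ^ (d + e + 1) * v t := by
    intro t
    rcases eq_or_ne t 0 with rfl | ht
    · simp [hu0, hp0]
    · simp only [v]; field_simp
  have hvt : Tendsto v (𝓝 0) (𝓝 0) := by
    have h1 : v =O[𝓝 0] fun t : ℝ => t ^ 1 :=
      isBigO_pow_of_isBigO_pow_mul (m := d + e + 1) (by simp [v])
        (by simpa only [← huv] using hup)
    refine h1.trans_tendsto ?_
    simpa using (continuous_pow 1).tendsto (0 : ℝ)
  have hvy : (fun t => v t - y t) =O[𝓝 0] fun t => G (t, v t) :=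
    (hG.hasStrictFDerivAt.isBigO_vertical (by rwa [hG']) hvt hyt).congr' EventuallyEq.rfl
      (hGy.mono fun t ht => by simp only [ht, sub_zero])
  refine ⟨fun t => p t + t ^ (d + e + 1) * y t, ?_, by simp [hp0], fun n => ?_⟩
  · exact hp.add ((analyticAt_id.pow _).mul hy)
  -- With `q` the witness, `u - q = t ^ N * (v - y)`; multiplied by `t ^ d` it is bounded by `t ^ (d
  -- + N) * G (t, v t) = A (t, u t)`, which is flat.
  · refine isBigO_pow_of_isBigO_pow_mul (m := d) (by simp [hu0, hp0]) ?_
    have h1 := (isBigO_refl (fun t : ℝ => t ^ (d + (d + e + 1))) (𝓝 0)).mul hvy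
    have h2 : (fun t => t ^ (d + (d + e + 1)) * G (t, v t)) =O[𝓝 0] fun t : ℝ => t ^ (d + n) := by
      refine (hflat (d + n)).congr' ?_ EventuallyEq.rfl
      filter_upwards [hAG v hvt] with t ht
      rw [← ht, ← huv]
      simp
    refine (h1.trans h2).congr_left fun t => ?_
    have : u t = p t + t ^ (d + e + 1) * v t := by rw [← huv]; ring
    rw [this]; ring

/-! ### Smooth annihilated functions are analytic. -/

theorem analyticAt_zero_of_annihilated {F : ℝ × ℝ → ℝ} (hF : AnalyticAt ℝ F 0)
    (hne : ¬ ∀ᶠ z in 𝓝 0, F z = 0) {u : ℝ → ℝ} (hu0 : u 0 = 0)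
    (hu : ∀ n : ℕ, ∃ p : ℝ → ℝ, AnalyticAt ℝ p 0 ∧ (fun t => u t - p t) =O[𝓝 0] fun t : ℝ => t ^ n)
    (h : ∀ᶠ t in 𝓝 0, F (t, u t) = 0) : AnalyticAt ℝ u 0 := by
  have hut : Tendsto u (𝓝 0) (𝓝 0) := by
    obtain ⟨p, hp, hup⟩ := hu 1
    have hp0 : p 0 = 0 := by
      have := eq_zero_of_isBigO_pow one_ne_zero hup
      rw [hu0] at this; linarith
    have hpt : Tendsto p (𝓝 0) (𝓝 0) := by simpa [hp0] using hp.continuousAt.tendsto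
    have hupt : Tendsto (fun t => u t - p t) (𝓝 0) (𝓝 0) :=
      hup.trans_tendsto (by simpa using (continuous_pow 1).tendsto (0 : ℝ))
    simpa using hupt.add hpt
  have hgu : Tendsto (fun t => (t, u t)) (𝓝 0) (𝓝 (0 : ℝ × ℝ)) := tendsto_id.prodMk_nhds hut
  obtain ⟨k, B, hB, hFB, hBne⟩ := hF.exists_eq_fst_pow_mul hne
  have hBu : ∀ᶠ t in 𝓝 0, B (t, u t) = 0 := by
    -- The factor `t ^ k` cancels off `t = 0`; continuity covers the origin.
    have h1 : ∀ᶠ t in 𝓝[≠] (0 : ℝ), B (t, u t) = 0 := by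
      filter_upwards [h.filter_mono nhdsWithin_le_nhds,
        (hgu.eventually hFB).filter_mono nhdsWithin_le_nhds, self_mem_nhdsWithin] with t h2 h3 ht
      rw [h2] at h3
      exact (mul_eq_zero.1 h3.symm).resolve_left (pow_ne_zero k ht)
    have h2 : B (0, u 0) = 0 := by
      have h3 : Tendsto (fun t => B (t, u t)) (𝓝[≠] 0) (𝓝 (B 0)) :=
        (hB.continuousAt.tendsto.comp hgu).mono_left nhdsWithin_le_nhds
      rw [hu0]
      exact tendsto_nhds_unique (h3.congr' h1) tendsto_const_nhds
    rw [eventually_nhdsWithin_iff] at h1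
    filter_upwards [h1] with t ht
    rcases eq_or_ne t 0 with rfl | htz
    · exact h2
    · exact ht htz
  obtain ⟨A, hA, hflat, N, hN⟩ := exists_flat_and_fderiv_not_flat hB hBne hu0 hBu
  obtain ⟨q, hq, hq0, huq⟩ := exists_analyticAt_sub_flat hA hu0 hu hflat hN
  have hq2 : AnalyticAt ℝ (fun z : ℝ × ℝ => q z.2) 0 :=
    AnalyticAt.comp (g := q) (f := fun z : ℝ × ℝ => z.2) hq analyticAt_snd
  have hcurve : AnalyticAt ℝ (fun z : ℝ × ℝ => (z.2, q z.2 + z.1)) 0 :=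
    analyticAt_snd.prod (hq2.add analyticAt_fst)
  -- The deviation from `q` is put first, so that its powers are the ones factored out.
  have hΦ : AnalyticAt ℝ (fun z : ℝ × ℝ => F (z.2, q z.2 + z.1)) 0 :=
    AnalyticAt.comp_of_eq hF hcurve (by simp [hq0])
  have hΦne : ¬ ∀ᶠ z : ℝ × ℝ in 𝓝 0, F (z.2, q z.2 + z.1) = 0 := by
    intro hz
    refine hne ?_
    have hback : Tendsto (fun z : ℝ × ℝ => (z.2 - q z.1, z.1)) (𝓝 0) (𝓝 0) := by
      have hq1 : ContinuousAt (fun z : ℝ × ℝ => q z.1) 0 :=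
        ContinuousAt.comp (g := q) (f := fun z : ℝ × ℝ => z.1) hq.continuousAt continuousAt_fst
      have := ((continuousAt_snd.sub hq1).prodMk continuousAt_fst).tendsto
      simpa [hq0, ← Prod.mk_zero_zero] using this
    filter_upwards [hback.eventually hz] with z hz
    simpa using hz
  have hw := eventually_eq_zero_of_analyticAt_of_flat hΦ hΦne huq (by
    filter_upwards [h] with t ht
    simpa using ht)
  exact hq.congr (hw.mono fun t ht => (sub_eq_zero.1 ht).symm)

/-- Taylor polynomials do this; the local argument uses smoothness of `u` only through them. -/
theorem ContDiffOn.exists_analyticAt_isBigO_sub {U : Set ℝ} (hU : IsOpen U) {u : ℝ → ℝ}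
    (hu : ContDiffOn ℝ ∞ u U) {t₀ : ℝ} (ht₀ : t₀ ∈ U) (n : ℕ) :
    ∃ p : ℝ → ℝ, AnalyticAt ℝ p t₀ ∧
      (fun t => u t - p t) =O[𝓝 t₀] fun t : ℝ => (t - t₀) ^ n := by
  obtain ⟨ε, hε, hball⟩ := Metric.isOpen_iff.1 hU t₀ ht₀
  have h := taylor_isLittleO (n := n) (convex_ball t₀ ε) (Metric.mem_ball_self hε)
    ((hu.mono hball).of_le (by exact_mod_cast le_top))
  rw [Metric.isOpen_ball.nhdsWithin_eq (Metric.mem_ball_self hε)] at h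
  refine ⟨_, ?_, h.isBigO⟩
  have : taylorWithinEval u n (Metric.ball t₀ ε) t₀ = fun x =>
      ∑ k ∈ Finset.range (n + 1),
        ((k.factorial : ℝ)⁻¹ * (x - t₀) ^ k) • iteratedDerivWithin k u (Metric.ball t₀ ε) t₀ :=
    funext fun x => taylor_within_apply u n _ t₀ x
  rw [this]
  fun_prop

/-- A smooth function whose graph is annihilated by a non-zero analytic germ is analytic. -/
theorem ContDiffOn.analyticAt_of_annihilated {U : Set ℝ} (hU : IsOpen U) {u : ℝ → ℝ}
    (hu : ContDiffOn ℝ ∞ u U) {t₀ : ℝ} (ht₀ : t₀ ∈ U) {F : ℝ × ℝ → ℝ}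
    (hF : AnalyticAt ℝ F (t₀, u t₀)) (hne : ¬ ∀ᶠ z in 𝓝 (t₀, u t₀), F z = 0)
    (h : ∀ᶠ t in 𝓝 t₀, F (t, u t) = 0) : AnalyticAt ℝ u t₀ := by
  have htr : Tendsto (fun s : ℝ => t₀ + s) (𝓝 0) (𝓝 t₀) := by
    simpa using (continuous_const_add t₀).tendsto (0 : ℝ)
  have htra : AnalyticAt ℝ (fun s : ℝ => t₀ + s) 0 := analyticAt_const.add analyticAt_id
  have key : AnalyticAt ℝ (fun s => u (t₀ + s) - u t₀) 0 := by
    refine analyticAt_zero_of_annihilated (F := fun z => F ((t₀, u t₀) + z)) ?_ ?_ (by simp) ?_ ?_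
    · exact AnalyticAt.comp_of_eq hF (analyticAt_const.add analyticAt_id) (by simp)
    · intro hz
      refine hne ?_
      have hback : Tendsto (fun z : ℝ × ℝ => z - (t₀, u t₀)) (𝓝 (t₀, u t₀)) (𝓝 0) := by
        simpa using (continuous_sub_right (t₀, u t₀)).tendsto (t₀, u t₀)
      filter_upwards [hback.eventually hz] with z hz
      simpa using hz
    · intro n
      obtain ⟨p, hp, hup⟩ := hu.exists_analyticAt_isBigO_sub hU ht₀ n
      refine ⟨fun s => p (t₀ + s) - u t₀, ?_, ?_⟩
      · exact (AnalyticAt.comp_of_eq hp htra (by simp)).sub analyticAt_const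
      · refine (hup.comp_tendsto htr).congr (fun s => ?_) fun s => ?_ <;> simp
    · filter_upwards [htr.eventually h] with s hs
      simpa using hs
  have hback : AnalyticAt ℝ (fun t : ℝ => t - t₀) t₀ := analyticAt_id.sub analyticAt_const
  have h1 := (AnalyticAt.comp_of_eq key hback (by simp)).add
    (analyticAt_const (v := u t₀))
  refine h1.congr (Eventually.of_forall fun t => ?_)
  simp

/-- A smooth function whose graph is annihilated by a non-zero analytic function on a connected
set is analytic. -/
theorem NontriviallyAnnihilated.analyticOnNhd {U : Set ℝ} (hU : IsOpen U) {u : ℝ → ℝ}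
    (hu : ContDiffOn ℝ ∞ u U) {X : Set (ℝ × ℝ)} (hX : IsPreconnected X)
    (h : NontriviallyAnnihilated U (graphMap u) X (analyticClass X)) : AnalyticOnNhd ℝ u U := by
  obtain ⟨hmaps, H, hH, ⟨x, hxX, hx⟩, hzero⟩ := h
  intro t ht
  refine hu.analyticAt_of_annihilated hU ht (hH _ (hmaps ht)) (fun hz => hx ?_) ?_
  · exact AnalyticOnNhd.eqOn_zero_of_preconnected_of_eventuallyEq_zero hH hX (hmaps ht) hz hxX
  · filter_upwards [hU.mem_nhds ht] with s hs using hzero s hs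

/-! ### The converse, uniqueness and differential equations. -/

theorem AnalyticOnNhd.nontriviallyAnnihilated {U : Set ℝ} (hne : U.Nonempty) {u : ℝ → ℝ}
    (hu : AnalyticOnNhd ℝ u U) :
    NontriviallyAnnihilated U (graphMap u) (U ×ˢ univ) (analyticClass (U ×ˢ univ)) := by
  refine ⟨fun t ht => ⟨ht, mem_univ _⟩, fun z => z.2 - u z.1, ?_, ?_, fun t _ => ?_⟩
  · intro z hz
    exact analyticAt_snd.sub
      (AnalyticAt.comp (g := u) (f := fun z : ℝ × ℝ => z.1) (hu z.1 hz.1) analyticAt_fst)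
  · obtain ⟨t, ht⟩ := hne
    exact ⟨(t, u t + 1), ⟨ht, mem_univ _⟩, by simp⟩
  · simp [graphMap]

/-- Adding an annihilator to `F` gives another solution, and the difference of two solutions is an
annihilator. -/
theorem isUniqueSolvedBy_analyticClass_iff {D E : Type*} [NormedAddCommGroup E] [NormedSpace ℝ E]
    {U : Set D} {g : D → E} {X : Set E} (hg : MapsTo g U X) {w : D → ℝ} {F : E → ℝ}
    (hF : F ∈ analyticClass X) (hFw : ∀ t ∈ U, F (g t) = w t) :
    IsUniqueSolvedBy U g X (analyticClass X) w F ↔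
      ¬ NontriviallyAnnihilated U g X (analyticClass X) := by
  have hF' : AnalyticOnNhd ℝ F X := hF
  constructor
  · rintro ⟨-, huniq⟩ ⟨-, H, hH, ⟨x, hxX, hx⟩, hzero⟩
    have hH' : AnalyticOnNhd ℝ H X := hH
    have := huniq (F + H) (hF'.add hH') (fun t ht => by simp [hzero t ht, hFw t ht]) hxX
    exact hx (by simpa using this)
  · intro hcon
    refine ⟨⟨hF, hFw⟩, fun G hG hGw => ?_⟩
    have hG' : AnalyticOnNhd ℝ G X := hG
    intro x hxX
    by_contra hx
    refine hcon ⟨hg, G - F, hG'.sub hF', ⟨x, hxX, ?_⟩, fun t ht => ?_⟩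
    · simpa [sub_eq_zero] using hx
    · simp [hGw t ht, hFw t ht]

/-- Differentiable solutions of an analytic first-order equation are smooth. -/
theorem contDiffOn_of_deriv_eq_analytic {U : Set ℝ} (hU : IsOpen U) {u : ℝ → ℝ}
    (hu : DifferentiableOn ℝ u U) {F : ℝ × ℝ → ℝ} (hF : AnalyticOnNhd ℝ F (U ×ˢ univ))
    (h : ∀ t ∈ U, deriv u t = F (t, u t)) : ContDiffOn ℝ ∞ u U := by
  have hF' : ContDiffOn ℝ ∞ F (U ×ˢ univ) := hF.contDiffOn (hU.prod isOpen_univ).uniqueDiffOn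
  rw [contDiffOn_infty]
  intro n
  induction n with
  | zero => exact contDiffOn_zero.2 hu.continuousOn
  | succ n ih =>
    rw [Nat.cast_add, Nat.cast_one, contDiffOn_succ_iff_deriv_of_isOpen hU]
    refine ⟨hu, by simp, ?_⟩
    -- Bootstrap: the equation makes `deriv u` as regular as `u`.
    refine ContDiffOn.congr ?_ h
    exact ContDiffOn.comp (g := F) (f := fun t => (t, u t))
      (hF'.of_le (by exact_mod_cast le_top)) (contDiffOn_id.prodMk ih)
      fun t ht => ⟨ht, mem_univ _⟩

theorem mainTheorem8 (U : Set ℝ) (hU : IsOpen U) (hne : U.Nonempty) (u : ℝ → ℝ) :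
    -- smooth functions on a (connected) open interval: the equivalence, and its form for uniqueness
    (IsPreconnected U → ContDiffOn ℝ ∞ u U →
      (NontriviallyAnnihilated U (graphMap u) (U ×ˢ univ) (analyticClass (U ×ˢ univ)) ↔
        AnalyticOnNhd ℝ u U) ∧
      (∀ (w : ℝ → ℝ) (F : ℝ × ℝ → ℝ), F ∈ analyticClass (U ×ˢ (univ : Set ℝ)) →
        (∀ t ∈ U, F (graphMap u t) = w t) →
        (IsUniqueSolvedBy U (graphMap u) (U ×ˢ univ) (analyticClass (U ×ˢ univ)) w F ↔
          ¬ AnalyticOnNhd ℝ u U))) ∧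
    -- differentiable solutions of an analytic first-order equation on an open interval
    (IsPreconnected U → DifferentiableOn ℝ u U →
      ∀ F : ℝ × ℝ → ℝ, F ∈ analyticClass (U ×ˢ (univ : Set ℝ)) →
        (∀ t ∈ U, deriv u t = F (t, u t)) →
        (NontriviallyAnnihilated U (graphMap u) (U ×ˢ univ) (analyticClass (U ×ˢ univ)) ↔
          AnalyticOnNhd ℝ u U) ∧
        (IsUniqueSolvedBy U (graphMap u) (U ×ˢ univ) (analyticClass (U ×ˢ univ)) (deriv u) F ↔
          ¬ AnalyticOnNhd ℝ u U)) ∧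
    -- arbitrary non-empty open sets: annihilation by an analytic function on the whole plane
    (ContDiffOn ℝ ∞ u U →
      NontriviallyAnnihilated U (graphMap u) univ (analyticClass univ) → AnalyticOnNhd ℝ u U) ∧
    -- arbitrary non-empty open sets: the converse, with analytic functions on the strip over the set
    (AnalyticOnNhd ℝ u U →
      NontriviallyAnnihilated U (graphMap u) (U ×ˢ univ) (analyticClass (U ×ˢ univ))) := by
  have hmaps : MapsTo (graphMap u) U (U ×ˢ univ) := fun t ht => ⟨ht, mem_univ _⟩
  have smooth : IsPreconnected U → ContDiffOn ℝ ∞ u U →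
      (NontriviallyAnnihilated U (graphMap u) (U ×ˢ univ) (analyticClass (U ×ˢ univ)) ↔
        AnalyticOnNhd ℝ u U) := fun hc hu =>
    ⟨fun h => h.analyticOnNhd hU hu (hc.prod isPreconnected_univ),
      fun h => h.nontriviallyAnnihilated hne⟩
  -- Only the domain of the annihilator must be connected; the plane is, so the third claim needs no
  -- connectedness of `U`.
  refine ⟨fun hc hu => ⟨smooth hc hu, fun w F hF hFw => ?_⟩, fun hc hu F hF hFu => ?_,
    fun hu h => h.analyticOnNhd hU hu isPreconnected_univ, fun h => h.nontriviallyAnnihilated hne⟩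
  · rw [isUniqueSolvedBy_analyticClass_iff hmaps hF hFw, smooth hc hu]
  · have hs := smooth hc (contDiffOn_of_deriv_eq_analytic hU hu hF hFu)
    refine ⟨hs, ?_⟩
    rw [isUniqueSolvedBy_analyticClass_iff hmaps hF fun t ht => (hFu t ht).symm, hs]
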